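/- Let $M,N$ be numbers of field modes and of two-level systems, $\boldsymbol\Lambda\in\mathbb{R}^{M\times N}$ and $\mathbf{t}\in\mathbb{R}^N$ with $\mathbf{t}\neq\mathbf{0}$. On $\mathcal{H}=L^2(\mathbb{R}^M,\mathbb{C}^{2^N})$, where $\mathbb{C}^{2^N}=\bigotimes^N\mathbb{C}^2$, let $\sigma_x^n,\sigma_z^n$ ($n=1,\dots,N$) be the Pauli matrices $\sigma_x=\begin{pmatrix}0&1\\1&0\end{pmatrix}$, $\sigma_z=\begin{pmatrix}1&0\\0&-1\end{pmatrix}$ acting on the $n$-th tensor factor, and consider $$\mathbf{H}_0=-\Delta+|\mathbf{x}|^2+\sum_{m=1}^M\sum_{n=1}^N x_m\Lambda_{mn}\sigma_z^n-\sum_{n=1}^N t_n\sigma_x^n .$$ Its form domain is $Q_0=\{\psi\in\mathcal{H}:\nabla\psi\in L^2,\ |\mathbf{x}|\psi\in L^2\}$ (with the distributional gradient), and for $\psi\in Q_0$ the quadratic form of $\mathbf{H}_0$ is $$\langle\psi,\mathbf{H}_0\psi\rangle=\|\nabla\psi\|^2+\|\mathbf{x}\psi\|^2+\sum_{m,n}\Lambda_{mn}\langle\psi,x_m\sigma_z^n\psi\rangle-\sum_n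 t_n\langle\psi,\sigma_x^n\psi\rangle .$$ For $\boldsymbol\sigma\in[-1,1]^N$ and $\boldsymbol\xi\in\mathbb{R}^M$ put $$\mathcal{M}_{\boldsymbol\sigma,\boldsymbol\xi}=\Big\{\psi\in Q_0:\ \|\psi\|=1,\ \langle\psi,\sigma_z^n\psi\rangle=\sigma_n\ (1\le n\le N),\ \int_{\mathbb{R}^M}x_m|\psi(\mathbf{x})|^2\,d\mathbf{x}=\xi_m\ (1\le m\le M)\Big\}$$ and define the Levy--Lieb functional by $F_{\mathrm{LL}}(\boldsymbol\sigma,\boldsymbol\xi)=\inf_{\psi\in\mathcal{M}_{\boldsymbol\sigma,\boldsymbol\xi}}\langle\psi,\mathbf{H}_0\psi\rangle$. Theorem (existence of an optimizer for $F_{\mathrm{LL}}$). For every $(\boldsymbol\sigma,\boldsymbol\xi)\in[-1,1]^N\times\mathbb{R}^M$ the infimum is attained: there exists $\psi\in\mathcal{M}_{\boldsymbol\sigma,\boldsymbol\xi}$ such that $F_{\mathrm{LL}}(\boldsymbol\sigma,\boldsymbol\xi)=\langle\psi,\mathbf{H}_0\psi\rangle$. -/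

import Mathlib

open MeasureTheory
open scoped SchwartzMap LineDeriv

noncomputable section

namespace Dicke

/-- Spin multi-indices `α ∈ {+,-}^N`; the value `0` stands for `+` and `1` for `-`. -/
abbrev Spin (N : ℕ) : Type := Fin N → Fin 2

/-- The configuration space `ℝ^M` of the `M` field modes. -/
abbrev Modes (M : ℕ) : Type := EuclideanSpace ℝ (Fin M)

/-- The spinor space `ℂ^{2^N}`. -/
abbrev Spinor (N : ℕ) : Type := EuclideanSpace ℂ (Spin N)

/-- The Hilbert space `L²(ℝ^M, ℂ^{2^N})`. -/
abbrev State (M N : ℕ) : Type := Lp (Spinor N) 2 (volume : Measure (Modes M))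

/-- The Pauli matrix `σ_x`. -/
def pauliX : Matrix (Fin 2) (Fin 2) ℂ := !![0, 1; 1, 0]

/-- The Pauli matrix `σ_z`. -/
def pauliZ : Matrix (Fin 2) (Fin 2) ℂ := !![1, 0; 0, -1]

/-- The lifted matrix `1 ⊗ ⋯ ⊗ A ⊗ ⋯ ⊗ 1`, with `A` in the `n`-th factor: its entries are the
products of the entries of the factors. -/
def lift {N : ℕ} (A : Matrix (Fin 2) (Fin 2) ℂ) (n : Fin N) : Matrix (Spin N) (Spin N) ℂ :=
  Matrix.of fun α β => ∏ k, (if k = n then A else 1) (α k) (β k)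

/-- A constant `2^N × 2^N` matrix acting pointwise on `L²(ℝ^M, ℂ^{2^N})`. -/
def matOp (M : ℕ) {N : ℕ} (A : Matrix (Spin N) (Spin N) ℂ) : State M N →L[ℂ] State M N :=
  (Matrix.toEuclideanCLM (n := Spin N) (𝕜 := ℂ) A).compLpL 2 volume

/-- `g ∈ L²` is the distributional partial derivative `∂ψ/∂x_m` of `ψ ∈ L²`. -/
def IsWeakDeriv {M N : ℕ} (m : Fin M) (ψ g : State M N) : Prop :=
  ∂_{(EuclideanSpace.single m 1 : Modes M)} (ψ : 𝓢'(Modes M, Spinor N)) = g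

/-- The distributional partial derivative `∂ψ/∂x_m` as an element of `L²`
(and `0` if it does not belong to `L²`). -/
def weakDeriv {M N : ℕ} (m : Fin M) (ψ : State M N) : State M N :=
  open Classical in if h : ∃ g, IsWeakDeriv m ψ g then h.choose else 0

theorem IsWeakDeriv.weakDeriv_eq {M N : ℕ} {m : Fin M} {ψ g : State M N}
    (h : IsWeakDeriv m ψ g) : weakDeriv m ψ = g := by
  have hex : ∃ g, IsWeakDeriv m ψ g := ⟨g, h⟩
  have h' : IsWeakDeriv m ψ (weakDeriv m ψ) := by
    rw [weakDeriv, dif_pos hex]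
    exact hex.choose_spec
  have hinj := LinearMap.ker_eq_bot.1 (Lp.ker_toTemperedDistributionCLM_eq_bot
    (F := Spinor N) (μ := (volume : Measure (Modes M))) (p := 2))
  exact hinj (h'.symm.trans h)

/-- The form domain `Q₀` of `H₀`: all `ψ ∈ L²` with `∇ψ ∈ L²` and `|x| ψ ∈ L²`. -/
def formDomain (M N : ℕ) : Set (State M N) :=
  {ψ | (∀ m, ∃ g, IsWeakDeriv m ψ g) ∧ MemLp (fun x : Modes M => ‖x‖ • ψ x) 2 volume}

/-- The matrix-valued function `x · Λσ_z = ∑_m ∑_n x_m Λ_{mn} σ_z^n`. -/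
def coupling {M N : ℕ} (Λ : Matrix (Fin M) (Fin N) ℝ) (x : Modes M) :
    Matrix (Spin N) (Spin N) ℂ :=
  ∑ m, ∑ n, ((x m * Λ m n : ℝ) : ℂ) • lift pauliZ n

/-- The matrix `t · σ_x = ∑_n t_n σ_x^n`. -/
def tunneling {N : ℕ} (t : Fin N → ℝ) : Matrix (Spin N) (Spin N) ℂ :=
  ∑ n, ((t n : ℝ) : ℂ) • lift pauliX n

/-- The quadratic form `⟨ψ, H₀ψ⟩` on `Q₀` of `H₀ = -Δ + |x|² + x·Λσ_z - t·σ_x`: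
`‖∇ψ‖² + ‖xψ‖² + ⟨ψ, x·Λσ_z ψ⟩ - ⟨ψ, t·σ_x ψ⟩`.
The last two terms are real because the matrices are Hermitian. -/
def energy {M N : ℕ} (Λ : Matrix (Fin M) (Fin N) ℝ) (t : Fin N → ℝ) (ψ : State M N) : ℝ :=
  (∑ m, ‖weakDeriv m ψ‖ ^ 2) + (∫ x : Modes M, ‖x‖ ^ 2 * ‖ψ x‖ ^ 2)
    + (∫ x : Modes M, (inner ℂ (ψ x)
        (Matrix.toEuclideanCLM (n := Spin N) (𝕜 := ℂ) (coupling Λ x) (ψ x))).re)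
    - (inner ℂ ψ (matOp M (tunneling t) ψ)).re

/-- The magnetization `σ_ψ = ⟨ψ, σ_z ψ⟩ ∈ ℝ^N` (real because `σ_z^n` is Hermitian). -/
def magnetization {M N : ℕ} (ψ : State M N) : Fin N → ℝ :=
  fun n => (inner ℂ ψ (matOp M (lift pauliZ n) ψ)).re

/-- The displacement `ξ_ψ = ∫ x |ψ(x)|² dx ∈ ℝ^M`. -/
def displacement {M N : ℕ} (ψ : State M N) : Fin M → ℝ :=
  fun m => ∫ x : Modes M, x m * ‖ψ x‖ ^ 2

/-- The constraint set `𝓜_{σ,ξ}`. -/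
def constraintSet {M N : ℕ} (σ : Fin N → ℝ) (ξ : Fin M → ℝ) : Set (State M N) :=
  {ψ | ψ ∈ formDomain M N ∧ ‖ψ‖ = 1 ∧ magnetization ψ = σ ∧ displacement ψ = ξ}

/-- The Levy–Lieb functional `F_LL(σ,ξ) = inf {⟨ψ, H₀ψ⟩ : ψ ∈ 𝓜_{σ,ξ}}`. -/
def levyLieb {M N : ℕ} (Λ : Matrix (Fin M) (Fin N) ℝ) (t : Fin N → ℝ)
    (σ : Fin N → ℝ) (ξ : Fin M → ℝ) : ℝ :=
  sInf (energy Λ t '' constraintSet σ ξ)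

end Dicke

end

/-! The proof is the direct method. The coupling is of first order in `x`, so half of `‖xψ‖²`
absorbs it, and the tunneling term is bounded. On unit vectors the energy thus bounds `‖∇ψ‖² +
‖xψ‖²/2` up to a constant (`HasFormData.exists_le_energy`). Along a minimizing sequence the
gradients and the vectors `x_m ψ` are therefore bounded, and a subsequence converges weakly together
with them.

The harmonic trap makes the form domain compactly embedded in `L²` (`tendsto_zero_of_weakTendsto`):
`‖xψ‖` controls the mass far out in position, `‖∇ψ‖` the mass far out in frequency, and between two
balls weak convergence is upgraded by dominated convergence. So the states converge strongly
(`exists_strong_limit`), and norm and magnetization pass to the limit. The displacement does too,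
being the pairing of the strongly convergent `ψ` with the weakly convergent `x_m ψ`; the coupling
term converges for the same reason. The two squared norms are weakly lower semicontinuous, so the
limit is a minimizer.

The constraint set is nonempty (`constraintSet_nonempty`): a product spinor realizes `σ`, and a bump
symmetric about `ξ` realizes `ξ`. -/

namespace Dicke

open Filter Topology

/-! ### Weak sequential compactness in Hilbert space -/

section WeakConvergence

variable {H H' : Type*} [NormedAddCommGroup H] [InnerProductSpace ℂ H]
  [NormedAddCommGroup H'] [InnerProductSpace ℂ H']

/-- Weak convergence of a sequence. -/
def WeakTendsto (u : ℕ → H) (v : H) : Prop :=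
  ∀ L : StrongDual ℂ H, Tendsto (fun k => L (u k)) atTop (𝓝 (L v))

theorem WeakTendsto.map {u : ℕ → H} {v : H} (h : WeakTendsto u v) (T : H →L[ℂ] H') :
    WeakTendsto (fun k => T (u k)) (T v) := fun L => h (L ∘L T)

theorem WeakTendsto.sub_const {u : ℕ → H} {v : H} (h : WeakTendsto u v) :
    WeakTendsto (fun k => u k - v) 0 := fun L => by
  simpa using (h L).sub_const (L v)

theorem WeakTendsto.inner_left {u : ℕ → H} {v : H} (h : WeakTendsto u v) (w : H) :
    Tendsto (fun k => inner ℂ w (u k)) atTop (𝓝 (inner ℂ w v)) :=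
  h (innerSL ℂ w)

/-- On a finite-dimensional space weak convergence is convergence. -/
theorem WeakTendsto.tendsto_euclidean {ι : Type*} [Fintype ι] {u : ℕ → EuclideanSpace ℂ ι}
    {v : EuclideanSpace ℂ ι} (h : WeakTendsto u v) : Tendsto u atTop (𝓝 v) := by
  have h1 : Tendsto (fun k => WithLp.ofLp (u k)) atTop (𝓝 (WithLp.ofLp v)) :=
    tendsto_pi_nhds.2 fun i => h (EuclideanSpace.proj i)
  exact ((PiLp.continuous_toLp 2 (fun _ : ι => ℂ)).tendsto (WithLp.ofLp v)).comp h1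

/-- The inner product of a strongly and a weakly convergent bounded sequence converges. -/
theorem WeakTendsto.inner_of_tendsto {u w : ℕ → H} {v z : H} (h : WeakTendsto u v)
    (hw : Tendsto w atTop (𝓝 z)) {C : ℝ} (hC : ∀ k, ‖u k‖ ≤ C) :
    Tendsto (fun k => inner ℂ (w k) (u k)) atTop (𝓝 (inner ℂ z v)) := by
  have h1 : Tendsto (fun k => inner ℂ (w k - z) (u k)) atTop (𝓝 0) := by
    refine squeeze_zero_norm (a := fun k => ‖w k - z‖ * C) (fun k => ?_) ?_
    · exact (norm_inner_le_norm _ _).trans (mul_le_mul_of_nonneg_left (hC k) (norm_nonneg _))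
    · simpa using (tendsto_iff_norm_sub_tendsto_zero.1 hw).mul_const C
  simpa [inner_sub_left] using h1.add (h.inner_left z)

/-- Sequential Banach–Alaoglu, transported by the Riesz isomorphism. That map is antilinear, hence
the complex conjugations. -/
theorem exists_weakTendsto_subseq [CompleteSpace H] [TopologicalSpace.SeparableSpace H]
    {u : ℕ → H} {C : ℝ} (hC : ∀ k, ‖u k‖ ≤ C) :
    ∃ v, ∃ φ : ℕ → ℕ, StrictMono φ ∧ WeakTendsto (fun k => u (φ k)) v := by
  obtain ⟨ℓ, -, φ, hφ, hlim⟩ := WeakDual.isSeqCompact_closedBall ℂ H 0 C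
    (x := fun k => StrongDual.toWeakDual (InnerProductSpace.toDual ℂ H (u k)))
    (fun k => by simpa using hC k)
  refine ⟨(InnerProductSpace.toDual ℂ H).symm (WeakDual.toStrongDual ℓ), φ, hφ, fun L => ?_⟩
  have h1 := ((WeakDual.eval_continuous ((InnerProductSpace.toDual ℂ H).symm L)).tendsto _).comp
    hlim
  have h2 := (Complex.continuous_conj.tendsto _).comp h1
  have key : ∀ x : H, L x = starRingEnd ℂ (inner ℂ x ((InnerProductSpace.toDual ℂ H).symm L)) := by
    intro x
    rw [inner_conj_symm, InnerProductSpace.toDual_symm_apply]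
  simp only [key]
  rw [InnerProductSpace.toDual_symm_apply]
  exact h2

/-- A bounded finite family of sequences has a common weakly convergent subsequence. -/
theorem exists_weakTendsto_subseq_pi [CompleteSpace H] [TopologicalSpace.SeparableSpace H]
    {ι : Type*} [Fintype ι]
    {u : ι → ℕ → H} {C : ℝ} (hC : ∀ i k, ‖u i k‖ ≤ C) :
    ∃ v : ι → H, ∃ φ : ℕ → ℕ, StrictMono φ ∧ ∀ i, WeakTendsto (fun k => u i (φ k)) (v i) := by
  have : SecondCountableTopology H := UniformSpace.secondCountable_of_separable H
  -- The family is a single bounded sequence in the `ℓ²` direct sum, so one extraction serves all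
  -- indices.
  obtain ⟨v, φ, hφ, hv⟩ := exists_weakTendsto_subseq
    (u := fun k => (WithLp.toLp 2 fun i => u i k : PiLp 2 fun _ : ι => H))
    (C := √(∑ _i : ι, C ^ 2)) (fun k => by
      rw [PiLp.norm_eq_of_L2]
      gcongr with i
      exact hC i k)
  exact ⟨v, φ, hφ, fun i => hv.map (PiLp.proj 2 (fun _ : ι => H) i)⟩

end WeakConvergence

/-! ### Derivatives and coordinates as operators on distributions -/

section Distributions

variable {M N : ℕ}

/-- The inclusion of `L²` into tempered distributions. -/
noncomputable abbrev toDistr : State M N →L[ℂ] 𝓢'(Modes M, Spinor N) :=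
  Lp.toTemperedDistributionCLM (Spinor N) (volume : Measure (Modes M)) 2

/-- The graph of a continuous operator on distributions is weakly closed in `L² × L²`. -/
theorem WeakTendsto.map_distr_eq (T : 𝓢'(Modes M, Spinor N) →L[ℂ] 𝓢'(Modes M, Spinor N))
    {u w : ℕ → State M N} {v z : State M N} (hu : WeakTendsto u v) (hw : WeakTendsto w z)
    (h : ∀ k, T (toDistr (u k)) = toDistr (w k)) : T (toDistr v) = toDistr z := by
  ext1 f
  -- Testing against a fixed `f` maps `L²` continuously into a finite-dimensional space, where weak
  -- limits are limits.
  let ev : 𝓢'(Modes M, Spinor N) →L[ℂ] Spinor N :=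
    PointwiseConvergenceCLM.evalCLM (RingHom.id ℂ) (Spinor N) f
  have h1 := (hu.map (ev ∘L T ∘L toDistr)).tendsto_euclidean
  have h2 := (hw.map (ev ∘L toDistr)).tendsto_euclidean
  refine tendsto_nhds_unique h1 (h2.congr fun k => (congrArg ev (h k)).symm)

/-- Multiplication by the coordinate `x_m` of tempered distributions. -/
noncomputable def coordMul (m : Fin M) : 𝓢'(Modes M, Spinor N) →L[ℂ] 𝓢'(Modes M, Spinor N) :=
  TemperedDistribution.smulLeftCLM (Spinor N) fun x : Modes M => ((x m : ℝ) : ℂ)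

theorem hasTemperateGrowth_coord (m : Fin M) :
    (fun x : Modes M => ((x m : ℝ) : ℂ)).HasTemperateGrowth :=
  (Complex.ofRealCLM ∘L (EuclideanSpace.proj m : Modes M →L[ℝ] ℝ)).hasTemperateGrowth

theorem coordMul_toDistr_apply (m : Fin M) (ψ : State M N) (f : 𝓢(Modes M, ℂ)) :
    coordMul m (toDistr ψ) f = ∫ x, f x • ((x m : ℝ) : ℂ) • ψ x := by
  rw [coordMul, TemperedDistribution.smulLeftCLM_apply_apply, Lp.toTemperedDistributionCLM_apply,
    Lp.toTemperedDistribution_apply]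
  refine integral_congr_ae (Eventually.of_forall fun x => ?_)
  simp only [SchwartzMap.smulLeftCLM_apply_apply (hasTemperateGrowth_coord m), smul_smul,
    smul_eq_mul, mul_comm]

/-- Links the distributional identity, which survives weak limits, to the pointwise formula needed
inside integrals. The forward direction is the fundamental lemma of the calculus of variations. -/
theorem coordMul_toDistr_eq_iff {m : Fin M} {ψ h : State M N} :
    coordMul m (toDistr ψ) = toDistr h ↔ h =ᵐ[volume] fun x => ((x m : ℝ) : ℂ) • ψ x := by
  constructor
  · intro heq
    refine ae_eq_of_integral_contDiff_smul_eq ((Lp.memLp h).locallyIntegrable (by norm_num)) ?_ ?_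
    · have h1 : LocallyIntegrable ψ (volume : Measure (Modes M)) :=
        (Lp.memLp ψ).locallyIntegrable (by norm_num)
      exact h1.continuous_smul (by fun_prop)
    · intro g g_smooth g_cpt
      have hg₁ : HasCompactSupport (Complex.ofRealCLM ∘ g) := g_cpt.comp_left rfl
      have hg₂ : ContDiff ℝ (⊤ : ℕ∞) (Complex.ofRealCLM ∘ g) := by fun_prop
      have h2 := DFunLike.congr_fun heq (hg₁.toSchwartzMap hg₂)
      rw [coordMul_toDistr_apply, Lp.toTemperedDistributionCLM_apply,
        Lp.toTemperedDistribution_apply] at h2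
      simpa using h2.symm
  · intro heq
    ext1 f
    rw [coordMul_toDistr_apply, Lp.toTemperedDistributionCLM_apply,
      Lp.toTemperedDistribution_apply]
    refine integral_congr_ae ?_
    filter_upwards [heq] with x hx
    rw [hx]

/-- The weak partial derivative acts as multiplication by `2πi p_m` in Fourier space. -/
theorem coordMul_fourier_of_isWeakDeriv {m : Fin M} {ψ g : State M N} (h : IsWeakDeriv m ψ g) :
    coordMul m (toDistr (FourierTransform.fourier ψ)) =
      toDistr ((2 * Real.pi * Complex.I)⁻¹ • FourierTransform.fourier g) := by
  have hc : (2 * Real.pi * Complex.I : ℂ) ≠ 0 := by simp [Real.pi_ne_zero]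
  have h1 := congrArg FourierTransform.fourier h
  rw [TemperedDistribution.fourier_lineDerivOp_eq, Lp.fourier_toTemperedDistribution_eq,
    Lp.fourier_toTemperedDistribution_eq] at h1
  rw [map_smul, Lp.toTemperedDistributionCLM_apply, Lp.toTemperedDistributionCLM_apply, ← h1,
    inv_smul_smul₀ hc, coordMul]
  congr 2
  ext x
  simp [EuclideanSpace.inner_single_right]

end Distributions

/-! ### The `L²` Fourier transform as an integral -/

section Fourier

variable {M N : ℕ}

/-- On `L¹ ∩ L²` the Fourier transform on `L²` is given by the Fourier integral. -/
theorem fourier_ae_eq_of_integrable {f : State M N} (hf : Integrable f volume) :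
    (FourierTransform.fourier f : State M N) =ᵐ[volume]
      FourierTransform.fourier (f : Modes M → Spinor N) := by
  refine ae_eq_of_integral_contDiff_smul_eq ((Lp.memLp _).locallyIntegrable (by norm_num)) ?_ ?_
  · exact Continuous.locallyIntegrable (VectorFourier.fourierIntegral_continuous
      Real.continuous_fourierChar (L := innerₗ (Modes M)) continuous_inner hf)
  · intro g g_smooth g_cpt
    have hg₁ : HasCompactSupport (Complex.ofRealCLM ∘ g) := g_cpt.comp_left rfl
    have hg₂ : ContDiff ℝ (⊤ : ℕ∞) (Complex.ofRealCLM ∘ g) := by fun_prop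
    -- Both transforms move onto the test function: the `L²` one by its compatibility with
    -- distributions, the integral one by Fubini.
    have h1 := DFunLike.congr_fun (Lp.fourier_toTemperedDistribution_eq f) (hg₁.toSchwartzMap hg₂)
    rw [TemperedDistribution.fourier_apply, Lp.toTemperedDistribution_apply,
        Lp.toTemperedDistribution_apply] at h1
    have h2 := VectorFourier.integral_fourierIntegral_smul_eq_flip (μ := volume) (ν := volume)
      (L := innerₗ (Modes M)) (f := hg₁.toSchwartzMap hg₂) (g := f) Real.continuous_fourierChar
      continuous_inner (hg₁.toSchwartzMap hg₂).integrable hf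
    have h3 : ∫ x, (Complex.ofRealCLM ∘ g) x • (FourierTransform.fourier f : State M N) x =
        ∫ x, (Complex.ofRealCLM ∘ g) x • FourierTransform.fourier (f : Modes M → Spinor N) x := by
      rw [SchwartzMap.fourier_coe] at h1
      rw [flip_innerₗ] at h2
      exact h1.symm.trans h2
    simpa using h3

end Fourier

/-! ### Truncation and tightness -/

section Cutoff

variable {M N : ℕ}

theorem norm_sq_eq_integral (f : State M N) : ‖f‖ ^ 2 = ∫ x, ‖f x‖ ^ 2 := by
  have h := L2.inner_def (𝕜 := ℂ) f f
  simp only [inner_self_eq_norm_sq_to_K] at h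
  have h2 : ((‖f‖ ^ 2 : ℝ) : ℂ) = ((∫ x, ‖f x‖ ^ 2 : ℝ) : ℂ) := by
    rw [← integral_complex_ofReal]
    simpa using h
  exact_mod_cast h2

theorem integrable_norm_sq (f : State M N) : Integrable (fun x => ‖f x‖ ^ 2) volume :=
  (memLp_two_iff_integrable_sq_norm (Lp.aestronglyMeasurable f)).1 (Lp.memLp f)

/-- Multiplication by the indicator function of `s`. -/
noncomputable def cutoff {s : Set (Modes M)} (hs : MeasurableSet s) :
    State M N →ₗ[ℂ] State M N where
  toFun ψ := ((Lp.memLp ψ).indicator hs).toLp _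
  map_add' ψ φ := by
    rw [← MemLp.toLp_add]
    refine MemLp.toLp_congr _ _ ?_
    filter_upwards [Lp.coeFn_add ψ φ] with x hx
    by_cases h : x ∈ s
    · simpa [h] using hx
    · simp [h]
  map_smul' c ψ := by
    rw [RingHom.id_apply, ← MemLp.toLp_const_smul]
    refine MemLp.toLp_congr _ _ ?_
    filter_upwards [Lp.coeFn_smul c ψ] with x hx
    by_cases h : x ∈ s
    · simpa [h] using hx
    · simp [h]

variable {s : Set (Modes M)} (hs : MeasurableSet s)

theorem cutoff_apply (ψ : State M N) :
    cutoff hs ψ = ((Lp.memLp ψ).indicator hs).toLp (s.indicator ψ) := rfl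

theorem coeFn_cutoff (ψ : State M N) : cutoff hs ψ =ᵐ[volume] s.indicator ψ := by
  rw [cutoff_apply]
  exact MemLp.coeFn_toLp _

theorem norm_cutoff_le (ψ : State M N) : ‖cutoff hs ψ‖ ≤ ‖ψ‖ := by
  refine Lp.norm_le_norm_of_ae_le ?_
  filter_upwards [coeFn_cutoff hs ψ] with x hx
  rw [hx]
  exact norm_indicator_le_norm_self _ _

theorem cutoff_add_cutoff_compl (ψ : State M N) : cutoff hs ψ + cutoff hs.compl ψ = ψ := by
  refine Lp.ext ?_
  filter_upwards [coeFn_cutoff hs ψ, coeFn_cutoff hs.compl ψ,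
    Lp.coeFn_add (cutoff hs ψ) (cutoff hs.compl ψ)] with x h1 h2 h3
  rw [h3, Pi.add_apply, h1, h2, Set.indicator_self_add_compl_apply]

theorem norm_sq_cutoff (ψ : State M N) : ‖cutoff hs ψ‖ ^ 2 = ∫ x in s, ‖ψ x‖ ^ 2 := by
  rw [norm_sq_eq_integral, ← integral_indicator hs]
  refine integral_congr_ae ?_
  filter_upwards [coeFn_cutoff hs ψ] with x hx
  by_cases h : x ∈ s <;> simp [h, hx]

/-- Second moments of an `L²` function in terms of its products with the coordinates. -/
theorem integral_normSq_mul_normSq {ψ : State M N} {h : Fin M → State M N}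
    (hh : ∀ m, coordMul m (toDistr ψ) = toDistr (h m)) :
    Integrable (fun x => ‖x‖ ^ 2 * ‖ψ x‖ ^ 2) volume ∧
      ∫ x, ‖x‖ ^ 2 * ‖ψ x‖ ^ 2 = ∑ m, ‖h m‖ ^ 2 := by
  have hae : (fun x => ∑ m, ‖h m x‖ ^ 2) =ᵐ[volume] fun x => ‖x‖ ^ 2 * ‖ψ x‖ ^ 2 := by
    have h1 : ∀ᵐ x, ∀ m, h m x = ((x m : ℝ) : ℂ) • ψ x :=
      ae_all_iff.2 fun m => coordMul_toDistr_eq_iff.1 (hh m)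
    filter_upwards [h1] with x hx
    simp only [hx, norm_smul, mul_pow, ← Finset.sum_mul, EuclideanSpace.norm_sq_eq x,
      Complex.norm_real]
  refine ⟨(integrable_finsetSum _ fun m _ => integrable_norm_sq (h m)).congr hae, ?_⟩
  rw [← integral_congr_ae hae, integral_finsetSum _ fun m _ => integrable_norm_sq (h m)]
  simp only [norm_sq_eq_integral]

/-- Tightness: a bound on `x ψ` controls the mass of `ψ` outside of a ball. -/
theorem norm_cutoff_compl_closedBall_le {ψ : State M N} {h : Fin M → State M N}
    (hh : ∀ m, coordMul m (toDistr ψ) = toDistr (h m)) {C : ℝ} (hC : ∀ m, ‖h m‖ ≤ C)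
    {R : ℝ} (hR : 0 < R) :
    ‖cutoff (Metric.isClosed_closedBall (x := (0 : Modes M)) (ε := R)).measurableSet.compl ψ‖ ≤
      √(M * C ^ 2) / R := by
  obtain ⟨hint, heq⟩ := integral_normSq_mul_normSq hh
  rw [le_div_iff₀ hR]
  refine Real.le_sqrt_of_sq_le ?_
  rw [mul_pow, norm_sq_cutoff, ← integral_mul_const]
  -- Chebyshev's inequality: `R² ≤ ‖x‖²` off the ball.
  calc _ ≤ ∫ x in (Metric.closedBall (0 : Modes M) R)ᶜ, ‖x‖ ^ 2 * ‖ψ x‖ ^ 2 := by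
        refine setIntegral_mono_on ((integrable_norm_sq ψ).mul_const _).integrableOn
          hint.integrableOn Metric.isClosed_closedBall.measurableSet.compl fun x hx => ?_
        have : R < ‖x‖ := by simpa using hx
        rw [mul_comm]
        gcongr
    _ ≤ ∫ x, ‖x‖ ^ 2 * ‖ψ x‖ ^ 2 :=
        setIntegral_le_integral hint (Eventually.of_forall fun x => by positivity)
    _ = ∑ m, ‖h m‖ ^ 2 := heq
    _ ≤ ∑ _m : Fin M, C ^ 2 := by
        gcongr with m
        exact hC m
    _ = M * C ^ 2 := by simp

end Cutoff

/-! ### Compact embedding by truncation in position and frequency -/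

section Compactness

variable {M N : ℕ}

/-- The localized plane wave `x ↦ 1_s(x) e^{-2πi x·p}` is square integrable. -/
theorem memLp_planeWave {s : Set (Modes M)} (hs : MeasurableSet s) (hfin : volume s ≠ ⊤)
    (p : Modes M) :
    MemLp (s.indicator fun x => (Real.fourierChar (-inner ℝ x p) : ℂ)) 2 volume := by
  rw [memLp_indicator_iff_restrict hs]
  have : IsFiniteMeasure (volume.restrict s) := ⟨by simpa using hfin.lt_top⟩
  refine MemLp.of_bound (Continuous.aestronglyMeasurable ?_) 1
    (Eventually.of_forall fun x => (Circle.norm_coe _).le)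
  have := Real.continuous_fourierChar
  fun_prop

/-- The Fourier transform at `p` of the restriction to `s`, as an operator on `L²`. -/
noncomputable def fourierAt (N : ℕ) {s : Set (Modes M)} (hs : MeasurableSet s) (hfin : volume s ≠ ⊤)
    (p : Modes M) : State M N →L[ℂ] Spinor N :=
  (ContinuousLinearMap.lsmul ℂ ℂ).lpPairing volume 2 2 ((memLp_planeWave hs hfin p).toLp _)

theorem fourier_cutoff_ae_eq {s : Set (Modes M)} (hs : MeasurableSet s) (hfin : volume s ≠ ⊤)
    (ψ : State M N) :
    (FourierTransform.fourier (cutoff hs ψ) : State M N) =ᵐ[volume]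
      fun p => fourierAt N hs hfin p ψ := by
  have hint : Integrable (cutoff hs ψ) volume := by
    refine Integrable.congr ?_ (coeFn_cutoff hs ψ).symm
    rw [integrable_indicator_iff hs]
    exact integrableOn_Lp_of_measure_ne_top ψ (by norm_num) hfin
  refine (fourier_ae_eq_of_integrable hint).trans (Eventually.of_forall fun p => ?_)
  simp only [fourierAt]
  rw [ContinuousLinearMap.lpPairing_eq_integral, Real.fourier_eq]
  refine integral_congr_ae ?_
  filter_upwards [coeFn_cutoff hs ψ, (memLp_planeWave hs hfin p).coeFn_toLp] with x h1 h2
  rw [h1, h2]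
  by_cases h : x ∈ s <;> simp [h, Circle.smul_def]

/-- The bound is uniform in `p` because plane waves have modulus one: on `s` their `L²` norm is that
of the indicator. -/
theorem exists_norm_fourierAt_apply_le (N : ℕ) {s : Set (Modes M)} (hs : MeasurableSet s)
    (hfin : volume s ≠ ⊤) : ∃ K : ℝ, 0 ≤ K ∧
      ∀ (p : Modes M) (ψ : State M N), ‖fourierAt N hs hfin p ψ‖ ≤ K * ‖ψ‖ := by
  refine ⟨‖(ContinuousLinearMap.lsmul ℂ ℂ : ℂ →L[ℂ] Spinor N →L[ℂ] Spinor N).lpPairing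
    (volume : Measure (Modes M)) 2 2‖ * ‖indicatorConstLp 2 hs hfin (1 : ℂ)‖, by positivity,
    fun p ψ => ?_⟩
  refine (ContinuousLinearMap.le_opNorm₂ _ _ _).trans ?_
  gcongr
  refine Lp.norm_le_norm_of_ae_le ?_
  filter_upwards [(memLp_planeWave hs hfin p).coeFn_toLp, indicatorConstLp_coeFn (hs := hs)
    (hμs := hfin) (c := (1 : ℂ)) (p := 2)] with x h1 h2
  rw [h1, h2]
  by_cases h : x ∈ s
  · simpa [h] using (Circle.norm_coe _).le
  · simp [h]

/-- At each `p` the localized transform is a continuous linear map, so it tends to zero along `u`;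
the uniform bound `K * C` is a dominating constant on the finite-measure set `t`. -/
theorem tendsto_cutoff_fourier_cutoff {s t : Set (Modes M)} (hs : MeasurableSet s)
    (hfin : volume s ≠ ⊤) (ht : MeasurableSet t) (htfin : volume t ≠ ⊤)
    {u : ℕ → State M N} (hu : WeakTendsto u 0) {C : ℝ} (hC : ∀ k, ‖u k‖ ≤ C) :
    Tendsto (fun k => ‖cutoff ht (FourierTransform.fourier (cutoff hs (u k)))‖) atTop (𝓝 0) := by
  obtain ⟨K, hK0, hK⟩ := exists_norm_fourierAt_apply_le N hs hfin
  have : IsFiniteMeasure (volume.restrict t) := ⟨by simpa using htfin.lt_top⟩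
  have h1 : Tendsto (fun k => ‖cutoff ht (FourierTransform.fourier (cutoff hs (u k)))‖ ^ 2)
      atTop (𝓝 (∫ _x in t, (0 : ℝ))) := by
    simp only [norm_sq_cutoff]
    have hae : ∀ k, ∀ᵐ p ∂(volume.restrict t),
        (FourierTransform.fourier (cutoff hs (u k)) : State M N) p = fourierAt N hs hfin p (u k) :=
      fun k => ae_restrict_of_ae (fourier_cutoff_ae_eq hs hfin (u k))
    refine tendsto_integral_of_dominated_convergence (fun _ => (K * C) ^ 2)
      (fun k => ?_) (integrable_const _) (fun k => ?_) ?_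
    · exact ((Lp.aestronglyMeasurable _).norm.pow 2).restrict
    · filter_upwards [hae k] with p hp
      rw [hp, Real.norm_of_nonneg (by positivity)]
      gcongr
      exact (hK p (u k)).trans (mul_le_mul_of_nonneg_left (hC k) hK0)
    · filter_upwards [ae_all_iff.2 hae] with p hp
      simp only [hp]
      have h2 := (hu.map (fourierAt N hs hfin p)).tendsto_euclidean.norm.pow 2
      simpa using h2
  have h3 := h1.sqrt
  simpa using h3

/-- Compactness of the embedding of the form domain into `L²`. -/
theorem tendsto_zero_of_weakTendsto {u : ℕ → State M N} (hu : WeakTendsto u 0)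
    {h g : Fin M → ℕ → State M N}
    (hh : ∀ m k, coordMul m (toDistr (u k)) = toDistr (h m k))
    (hg : ∀ m k, coordMul m (toDistr (FourierTransform.fourier (u k))) = toDistr (g m k))
    {C : ℝ} (hC : ∀ k, ‖u k‖ ≤ C) (hCh : ∀ m k, ‖h m k‖ ≤ C) (hCg : ∀ m k, ‖g m k‖ ≤ C) :
    Tendsto u atTop (𝓝 0) := by
  -- By Plancherel three tails are lost: the position tail of `u k` twice (once directly, once
  -- inside the Fourier transform) and its frequency tail once.
  have key : ∀ R : ℝ, 0 < R → ∀ k, ‖u k‖ ≤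
      ‖cutoff (Metric.isClosed_closedBall (x := (0 : Modes M)) (ε := R)).measurableSet
        (FourierTransform.fourier (cutoff (Metric.isClosed_closedBall (x := (0 : Modes M))
          (ε := R)).measurableSet (u k)))‖ + 3 * (√(M * C ^ 2) / R) := by
    intro R hR k
    have hB := (Metric.isClosed_closedBall (x := (0 : Modes M)) (ε := R)).measurableSet
    have t1 := norm_cutoff_compl_closedBall_le (fun m => hh m k) (fun m => hCh m k) hR
    have t2 := norm_cutoff_compl_closedBall_le (fun m => hg m k) (fun m => hCg m k) hR
    have e1 := cutoff_add_cutoff_compl hB (u k)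
    have e2 := cutoff_add_cutoff_compl hB
      (FourierTransform.fourier (cutoff hB (u k)) : State M N)
    have n1 : ‖u k‖ ≤ ‖cutoff hB (u k)‖ + ‖cutoff hB.compl (u k)‖ := by
      conv_lhs => rw [← e1]
      exact norm_add_le _ _
    have n2 : ‖cutoff hB (u k)‖ ≤
        ‖cutoff hB (FourierTransform.fourier (cutoff hB (u k)) : State M N)‖ +
        ‖cutoff hB.compl (FourierTransform.fourier (cutoff hB (u k)) : State M N)‖ := by
      rw [← Lp.norm_fourier_eq (cutoff hB (u k))]
      conv_lhs => rw [← e2]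
      exact norm_add_le _ _
    have e3 : (FourierTransform.fourier (cutoff hB (u k)) : State M N) =
        FourierTransform.fourier (u k) - FourierTransform.fourier (cutoff hB.compl (u k)) := by
      rw [eq_sub_iff_add_eq, ← FourierTransform.fourier_add, e1]
    have n3 : ‖cutoff hB.compl (FourierTransform.fourier (cutoff hB (u k)) : State M N)‖ ≤
        ‖cutoff hB.compl (FourierTransform.fourier (u k) : State M N)‖ +
          ‖cutoff hB.compl (u k)‖ := by
      rw [e3, map_sub]
      refine (norm_sub_le _ _).trans (add_le_add_right ?_ _)
      exact (norm_cutoff_le _ _).trans (Lp.norm_fourier_eq _).le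
    linarith
  rw [tendsto_zero_iff_norm_tendsto_zero, Metric.tendsto_atTop]
  intro ε hε
  set A := √(M * C ^ 2)
  have hA : 0 ≤ A := Real.sqrt_nonneg _
  -- This makes `3 * (A / R)` equal to `(ε / 2) * A / (A + 1)`; the `+ 1` keeps `R` positive when `A
  -- = 0`.
  set R := 6 * (A + 1) / ε with hRdef
  have hR : 0 < R := by positivity
  have hAR : 3 * (A / R) < ε / 2 := by
    rw [hRdef, div_div_eq_mul_div, mul_div_assoc', div_lt_iff₀ (by positivity)]
    nlinarith
  have hfin : volume (Metric.closedBall (0 : Modes M) R) ≠ ⊤ := measure_closedBall_lt_top.ne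
  have hB := (Metric.isClosed_closedBall (x := (0 : Modes M)) (ε := R)).measurableSet
  obtain ⟨n, hn⟩ := (Metric.tendsto_atTop.1
    (tendsto_cutoff_fourier_cutoff hB hfin hB hfin hu hC)) (ε / 2) (by positivity)
  refine ⟨n, fun k hk => ?_⟩
  have h1 := hn k hk
  have h2 := key R hR k
  simp only [dist_zero_right, norm_norm] at h1 ⊢
  linarith

end Compactness

/-! ### The energy in terms of `ψ`, `∇ψ` and `xψ`; coercivity -/

section Energy

variable {M N : ℕ}

theorem isWeakDeriv_iff {m : Fin M} {ψ g : State M N} : IsWeakDeriv m ψ g ↔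
    LineDeriv.lineDerivOpCLM ℂ 𝓢'(Modes M, Spinor N) (EuclideanSpace.single m 1 : Modes M)
      (toDistr ψ) = toDistr g := Iff.rfl

/-- `ψ` belongs to the form domain, `g` is its gradient and `h` is `x ψ`. -/
structure HasFormData (ψ : State M N) (g h : Fin M → State M N) : Prop where
  deriv : ∀ m, IsWeakDeriv m ψ (g m)
  coord : ∀ m, coordMul m (toDistr ψ) = toDistr (h m)

/-- Rests on `|x_m| ≤ ‖x‖` in one direction and `‖x‖² = ∑ x_m²` in the other. -/
theorem mem_formDomain_iff {ψ : State M N} :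
    ψ ∈ formDomain M N ↔ ∃ g h, HasFormData ψ g h := by
  constructor
  · rintro ⟨hd, hx⟩
    choose g hg using hd
    have hmem : ∀ m, MemLp (fun x : Modes M => ((x m : ℝ) : ℂ) • ψ x) 2 volume := fun m => by
      refine hx.of_le ?_ (Eventually.of_forall fun x => ?_)
      · have h1 : Continuous fun x : Modes M => ((x m : ℝ) : ℂ) := by fun_prop
        exact h1.aestronglyMeasurable.smul (Lp.aestronglyMeasurable ψ)
      · rw [norm_smul, norm_smul, Complex.norm_real, norm_norm]
        gcongr
        exact PiLp.norm_apply_le x m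
    exact ⟨g, fun m => (hmem m).toLp _, hg,
      fun m => coordMul_toDistr_eq_iff.2 (hmem m).coeFn_toLp⟩
  · rintro ⟨g, h, hd, hx⟩
    refine ⟨fun m => ⟨g m, hd m⟩, ?_⟩
    refine (memLp_two_iff_integrable_sq_norm
      (continuous_norm.aestronglyMeasurable.smul (Lp.aestronglyMeasurable ψ))).2 ?_
    simpa [norm_smul, mul_pow] using (integral_normSq_mul_normSq hx).1

theorem re_inner_eq_integral (f g : State M N) :
    (inner ℂ f g).re = ∫ x, (inner ℂ (f x) (g x)).re := by
  rw [L2.inner_def]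
  exact (Complex.reCLM.integral_comp_comm (L2.integrable_inner f g)).symm

theorem integrable_re_inner (f g : State M N) :
    Integrable (fun x => (inner ℂ (f x) (g x)).re) volume :=
  Complex.reCLM.integrable_comp (L2.integrable_inner f g)

theorem coeFn_matOp (A : Matrix (Spin N) (Spin N) ℂ) (f : State M N) :
    ∀ᵐ x, matOp M A f x = Matrix.toEuclideanCLM (n := Spin N) (𝕜 := ℂ) A (f x) :=
  ContinuousLinearMap.coeFn_compLp _ f

theorem HasFormData.displacement_eq {ψ : State M N} {g h : Fin M → State M N}
    (H : HasFormData ψ g h) (m : Fin M) : displacement ψ m = (inner ℂ ψ (h m)).re := by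
  rw [re_inner_eq_integral]
  refine integral_congr_ae ?_
  filter_upwards [coordMul_toDistr_eq_iff.1 (H.coord m)] with x hx
  simp only [hx, inner_smul_right, inner_self_eq_norm_sq_to_K]
  rw [Complex.re_ofReal_mul]
  norm_cast

/-- Leaves only norms and inner products of `L²` vectors, to which weak convergence applies. -/
theorem HasFormData.energy_eq {ψ : State M N} {g h : Fin M → State M N}
    (H : HasFormData ψ g h) (Λ : Matrix (Fin M) (Fin N) ℝ) (t : Fin N → ℝ) :
    energy Λ t ψ = (∑ m, ‖g m‖ ^ 2) + (∑ m, ‖h m‖ ^ 2)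
      + (∑ m, ∑ n, Λ m n * (inner ℂ ψ (matOp M (lift pauliZ n) (h m))).re)
      - (inner ℂ ψ (matOp M (tunneling t) ψ)).re := by
  have hcoupl : (∫ x : Modes M, (inner ℂ (ψ x)
      (Matrix.toEuclideanCLM (n := Spin N) (𝕜 := ℂ) (coupling Λ x) (ψ x))).re) =
      ∑ m, ∑ n, Λ m n * (inner ℂ ψ (matOp M (lift pauliZ n) (h m))).re := by
    simp only [re_inner_eq_integral, ← integral_const_mul]
    have hint : ∀ m n, Integrable (fun x => Λ m n *
        (inner ℂ (ψ x) (matOp M (lift pauliZ n) (h m) x)).re) volume :=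
      fun m n => (integrable_re_inner _ _).const_mul _
    simp only [← integral_finsetSum _ fun n _ => hint _ n]
    rw [← integral_finsetSum _ fun m _ => integrable_finsetSum _ fun n _ => hint m n]
    refine integral_congr_ae ?_
    have h1 : ∀ᵐ x, ∀ m, h m x = ((x m : ℝ) : ℂ) • ψ x :=
      ae_all_iff.2 fun m => coordMul_toDistr_eq_iff.1 (H.coord m)
    have h2 : ∀ᵐ x, ∀ m n, matOp M (lift pauliZ n) (h m) x =
        Matrix.toEuclideanCLM (n := Spin N) (𝕜 := ℂ) (lift pauliZ n) (h m x) :=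
      ae_all_iff.2 fun m => ae_all_iff.2 fun n => coeFn_matOp _ _
    filter_upwards [h1, h2] with x hx1 hx2
    simp only [hx1, hx2, coupling, map_sum, map_smul, inner_sum, inner_smul_right,
      sum_apply, smul_apply, Complex.re_sum]
    refine Finset.sum_congr rfl fun m _ => Finset.sum_congr rfl fun n _ => ?_
    rw [Complex.re_ofReal_mul, Complex.re_ofReal_mul]
    ring
  rw [energy, hcoupl, (integral_normSq_mul_normSq H.coord).2]
  simp only [(H.deriv _).weakDeriv_eq]

/-- A lower bound for the energy that controls the gradient and the second moments. -/
theorem HasFormData.exists_le_energy (Λ : Matrix (Fin M) (Fin N) ℝ) (t : Fin N → ℝ) :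
    ∃ K : ℝ, ∀ (ψ : State M N) (g h : Fin M → State M N), HasFormData ψ g h → ‖ψ‖ = 1 →
      (∑ m, ‖g m‖ ^ 2) + (∑ m, ‖h m‖ ^ 2) / 2 ≤ energy Λ t ψ + K := by
  let c : Fin M → ℝ := fun m => ∑ n, |Λ m n| * ‖matOp M (lift pauliZ n : Matrix (Spin N) _ ℂ)‖
  refine ⟨(∑ m, c m ^ 2 / 2) + ‖matOp M (tunneling t)‖, fun ψ g h H hψ => ?_⟩
  rw [H.energy_eq Λ t]
  have h1 : (inner ℂ ψ (matOp M (tunneling t) ψ)).re ≤ ‖matOp M (tunneling t)‖ := by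
    refine (Complex.re_le_norm _).trans ((norm_inner_le_norm _ _).trans ?_)
    simpa [hψ] using (matOp M (tunneling t)).le_opNorm ψ
  -- Cauchy–Schwarz, then `c‖h‖ ≤ (c² + ‖h‖²)/2`.
  have h2 : ∀ m, -(‖h m‖ ^ 2 / 2) - c m ^ 2 / 2 ≤
      ∑ n, Λ m n * (inner ℂ ψ (matOp M (lift pauliZ n) (h m))).re := by
    intro m
    have h3 : |∑ n, Λ m n * (inner ℂ ψ (matOp M (lift pauliZ n) (h m))).re| ≤ c m * ‖h m‖ := by
      refine (Finset.abs_sum_le_sum_abs _ _).trans ?_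
      rw [Finset.sum_mul]
      refine Finset.sum_le_sum fun n _ => ?_
      rw [abs_mul, mul_assoc]
      gcongr
      refine (Complex.abs_re_le_norm _).trans ((norm_inner_le_norm _ _).trans ?_)
      simpa [hψ] using (matOp M (lift pauliZ n)).le_opNorm (h m)
    have h4 := (abs_le.1 h3).1
    nlinarith [sq_nonneg (c m - ‖h m‖)]
  have h5 := Finset.sum_le_sum fun m (_ : m ∈ Finset.univ) => h2 m
  rw [Finset.sum_sub_distrib, Finset.sum_neg_distrib, ← Finset.sum_div] at h5
  linarith

end Energy

/-! ### Limit of a minimizing sequence -/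

section Minimizer

variable {M N : ℕ}

theorem separableSpace_state : TopologicalSpace.SeparableSpace (State M N) := by
  have : Fact ((2 : ENNReal) ≠ ⊤) := ⟨by norm_num⟩
  infer_instance

/-- A sequence in the form domain with bounded data converges strongly in `L²` along a
subsequence, and weakly together with its data. -/
theorem exists_strong_limit {u : ℕ → State M N} {g h : Fin M → ℕ → State M N}
    (H : ∀ k, HasFormData (u k) (g · k) (h · k)) {C : ℝ} (hu : ∀ k, ‖u k‖ ≤ C)
    (hg : ∀ m k, ‖g m k‖ ≤ C) (hh : ∀ m k, ‖h m k‖ ≤ C) :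
    ∃ (ψ : State M N) (g' h' : Fin M → State M N) (φ : ℕ → ℕ), StrictMono φ ∧
      HasFormData ψ g' h' ∧ Tendsto (fun k => u (φ k)) atTop (𝓝 ψ) ∧
      (∀ m, WeakTendsto (fun k => g m (φ k)) (g' m)) ∧
      ∀ m, WeakTendsto (fun k => h m (φ k)) (h' m) := by
  have := separableSpace_state (M := M) (N := N)
  obtain ⟨v, φ, hφ, hv⟩ := exists_weakTendsto_subseq_pi
    (u := fun i : Option (Fin M ⊕ Fin M) => i.elim u (Sum.elim g h)) (C := C) (by
      rintro (_ | m | m) k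
      exacts [hu k, hg m k, hh m k])
  have hv0 : WeakTendsto (fun k => u (φ k)) (v none) := hv none
  have hvg : ∀ m, WeakTendsto (fun k => g m (φ k)) (v (some (.inl m))) :=
    fun m => hv (some (.inl m))
  have hvh : ∀ m, WeakTendsto (fun k => h m (φ k)) (v (some (.inr m))) :=
    fun m => hv (some (.inr m))
  have HF : HasFormData (v none) (fun m => v (some (.inl m))) (fun m => v (some (.inr m))) :=
    ⟨fun m => isWeakDeriv_iff.2 (hv0.map_distr_eq _ (hvg m) fun k => (H (φ k)).deriv m),
      fun m => hv0.map_distr_eq _ (hvh m) fun k => (H (φ k)).coord m⟩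
  refine ⟨v none, _, _, φ, hφ, HF, ?_, hvg, hvh⟩
  rw [tendsto_iff_norm_sub_tendsto_zero, ← tendsto_zero_iff_norm_tendsto_zero]
  -- One bound for all differences with the weak limits; the Fourier factor `(2πi)⁻¹` has modulus at
  -- most one and does not enlarge it.
  let D := C + ∑ i, ‖v i‖
  have hD : ∀ i, ‖v i‖ ≤ ∑ i, ‖v i‖ := fun i =>
    Finset.single_le_sum (f := fun i => ‖v i‖) (fun _ _ => norm_nonneg _) (Finset.mem_univ i)
  have hDu : ∀ i (w : State M N), ‖w‖ ≤ C → ‖w - v i‖ ≤ D := fun i w hw =>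
    (norm_sub_le _ _).trans (add_le_add hw (hD i))
  have hD0 : 0 ≤ D := (norm_nonneg _).trans (hDu none (u 0) (hu 0))
  have hπ : ‖(2 * Real.pi * Complex.I : ℂ)⁻¹‖ ≤ 1 := by
    rw [norm_inv]
    refine inv_le_one_of_one_le₀ ?_
    simp only [Complex.norm_mul, Complex.norm_ofNat, Complex.norm_real, Complex.norm_I, mul_one,
      Real.norm_of_nonneg Real.pi_pos.le]
    linarith [Real.pi_gt_three]
  refine tendsto_zero_of_weakTendsto (C := D) hv0.sub_const
    (h := fun m k => h m (φ k) - v (some (.inr m)))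
    (g := fun m k => (2 * Real.pi * Complex.I : ℂ)⁻¹ •
      (FourierTransform.fourier (g m (φ k) - v (some (.inl m))) : State M N)) ?_ ?_
    (fun k => hDu _ _ (hu _)) (fun m k => hDu _ _ (hh _ _)) (fun m k => ?_)
  · intro m k
    rw [map_sub, map_sub, (H (φ k)).coord, HF.coord, map_sub]
  · intro m k
    refine coordMul_fourier_of_isWeakDeriv (isWeakDeriv_iff.2 ?_)
    rw [map_sub, map_sub, isWeakDeriv_iff.1 ((H (φ k)).deriv m), isWeakDeriv_iff.1 (HF.deriv m),
      map_sub]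
  · rw [norm_smul, Lp.norm_fourier_eq]
    calc _ ≤ 1 * D := by
          gcongr
          exact hDu _ _ (hg _ _)
      _ = D := one_mul D

/-- The quadratic lower bound behind the weak lower semicontinuity of the norm. -/
theorem two_re_inner_sub_le {H : Type*} [NormedAddCommGroup H] [InnerProductSpace ℂ H] (v w : H) :
    2 * (inner ℂ v w).re - ‖v‖ ^ 2 ≤ ‖w‖ ^ 2 := by
  have h1 : (inner ℂ v w).re ≤ ‖v‖ * ‖w‖ := (Complex.re_le_norm _).trans (norm_inner_le_norm _ _)
  nlinarith [sq_nonneg (‖v‖ - ‖w‖)]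

/-- The affine minorant of `‖u k‖²` is exact in the limit, which gives lower semicontinuity without
a `liminf`. -/
theorem WeakTendsto.tendsto_two_re_inner_sub {H : Type*} [NormedAddCommGroup H]
    [InnerProductSpace ℂ H] {u : ℕ → H} {v : H} (h : WeakTendsto u v) :
    Tendsto (fun k => 2 * (inner ℂ v (u k)).re - ‖v‖ ^ 2) atTop (𝓝 (‖v‖ ^ 2)) := by
  have h1 := (((Complex.continuous_re.tendsto _).comp (h.inner_left v)).const_mul 2).sub_const
    (‖v‖ ^ 2)
  have h2 : (inner ℂ v v).re = ‖v‖ ^ 2 := inner_self_eq_norm_sq (𝕜 := ℂ) v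
  rw [h2, two_mul, add_sub_cancel_right] at h1
  exact h1

theorem mem_constraintSet_iff {σ : Fin N → ℝ} {ξ : Fin M → ℝ} {ψ : State M N} :
    ψ ∈ constraintSet σ ξ ↔
      ψ ∈ formDomain M N ∧ ‖ψ‖ = 1 ∧ magnetization ψ = σ ∧ displacement ψ = ξ := Iff.rfl

theorem exists_isMinOn_energy (Λ : Matrix (Fin M) (Fin N) ℝ) (t : Fin N → ℝ)
    {σ : Fin N → ℝ} {ξ : Fin M → ℝ} (hne : (constraintSet σ ξ : Set (State M N)).Nonempty) :
    ∃ ψ ∈ (constraintSet σ ξ : Set (State M N)),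
      ∀ φ ∈ (constraintSet σ ξ : Set (State M N)), energy Λ t ψ ≤ energy Λ t φ := by
  obtain ⟨K, hK⟩ := HasFormData.exists_le_energy Λ t
  have hnn : ∀ g h : Fin M → State M N, 0 ≤ (∑ m, ‖g m‖ ^ 2) + (∑ m, ‖h m‖ ^ 2) / 2 :=
    fun g h => add_nonneg (Finset.sum_nonneg fun _ _ => sq_nonneg _)
      (div_nonneg (Finset.sum_nonneg fun _ _ => sq_nonneg _) zero_le_two)
  have hbdd : BddBelow (energy Λ t '' constraintSet σ ξ) := by
    refine ⟨-K, ?_⟩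
    rintro _ ⟨ψ, hmem, rfl⟩
    obtain ⟨hψ, hn, -⟩ := mem_constraintSet_iff.1 hmem
    obtain ⟨g, h, H⟩ := mem_formDomain_iff.1 hψ
    have h1 := hK ψ g h H hn
    exact neg_le_iff_add_nonneg.2 ((hnn g h).trans h1)
  obtain ⟨E, -, hElim, hEmem⟩ := exists_seq_tendsto_sInf (hne.image (energy Λ t)) hbdd
  choose u hu' huE using hEmem
  have hu := fun k => mem_constraintSet_iff.1 (hu' k)
  have hdata : ∀ k, ∃ g h, HasFormData (u k) g h := fun k => mem_formDomain_iff.1 (hu k).1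
  choose g h H using hdata
  obtain ⟨B, hB⟩ := hElim.bddAbove_range
  have hEB : ∀ k, (∑ m, ‖g k m‖ ^ 2) + (∑ m, ‖h k m‖ ^ 2) / 2 ≤ B + K := fun k => by
    have h1 := hK _ _ _ (H k) (hu k).2.1
    have h2 : E k ≤ B := hB ⟨k, rfl⟩
    rw [huE k] at h1
    linarith
  have hgB : ∀ m k, ‖g k m‖ ^ 2 ≤ 2 * (B + K) + 1 ∧ ‖h k m‖ ^ 2 ≤ 2 * (B + K) + 1 := by
    intro m k
    have h1 := Finset.single_le_sum (f := fun m => ‖g k m‖ ^ 2) (fun _ _ => sq_nonneg _)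
      (Finset.mem_univ m)
    have h2 := Finset.single_le_sum (f := fun m => ‖h k m‖ ^ 2) (fun _ _ => sq_nonneg _)
      (Finset.mem_univ m)
    have h3 := hEB k
    have h4 := sq_nonneg ‖g k m‖
    have h5 := sq_nonneg ‖h k m‖
    constructor <;> linarith
  -- The `+ 1` ensures `1 ≤ C`, so `C` also bounds the unit vectors `u k`.
  set C := √(2 * (B + K) + 1) with hC
  have hBK : 0 ≤ B + K := (hnn _ _).trans (hEB 0)
  have hC1 : 1 ≤ C := Real.one_le_sqrt.2 (by linarith)
  obtain ⟨ψ, g', h', φ, hφ, HF, hlim, hg', hh'⟩ := exists_strong_limit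
    (g := fun m k => g k m) (h := fun m k => h k m) H (C := C)
    (fun k => (hu k).2.1.le.trans hC1) (fun m k => Real.le_sqrt_of_sq_le (hgB m k).1)
    (fun m k => Real.le_sqrt_of_sq_le (hgB m k).2)
  have hre : ∀ {a : ℕ → ℂ} {b : ℂ}, Tendsto a atTop (𝓝 b) →
      Tendsto (fun k => (a k).re) atTop (𝓝 b.re) :=
    fun hab => (Complex.continuous_re.tendsto _).comp hab
  have hmat : ∀ A : Matrix (Spin N) (Spin N) ℂ,
      Tendsto (fun k => (inner ℂ (u (φ k)) (matOp M A (u (φ k)))).re) atTop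
        (𝓝 (inner ℂ ψ (matOp M A ψ)).re) := fun A =>
    hre (hlim.inner (((matOp M A).continuous.tendsto _).comp hlim))
  have hψ : ψ ∈ (constraintSet σ ξ : Set (State M N)) := by
    refine mem_constraintSet_iff.2 ⟨mem_formDomain_iff.2 ⟨_, _, HF⟩, ?_, ?_, ?_⟩
    · refine tendsto_nhds_unique hlim.norm ?_
      simp only [(hu _).2.1]
      exact tendsto_const_nhds
    · ext n
      refine tendsto_nhds_unique (hmat (lift pauliZ n)) ?_
      refine tendsto_const_nhds.congr fun k => ?_
      exact (congrFun (hu (φ k)).2.2.1 n).symm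
    · ext m
      rw [HF.displacement_eq]
      refine tendsto_nhds_unique (hre ((hh' m).inner_of_tendsto hlim
        (fun k => Real.le_sqrt_of_sq_le (hgB m (φ k)).2))) ?_
      refine tendsto_const_nhds.congr fun k => ?_
      rw [← (H (φ k)).displacement_eq]
      exact (congrFun (hu (φ k)).2.2.2 m).symm
  refine ⟨ψ, hψ, ?_⟩
  have hle : energy Λ t ψ ≤ sInf (energy Λ t '' constraintSet σ ξ) := by
    rw [HF.energy_eq Λ t]
    -- The squared norms are replaced by their affine minorants; the resulting sequence lies below
    -- the energies and converges to the energy of `ψ`.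
    refine le_of_tendsto_of_tendsto
      (f := fun k => (∑ m, (2 * (inner ℂ (g' m) (g (φ k) m)).re - ‖g' m‖ ^ 2))
        + (∑ m, (2 * (inner ℂ (h' m) (h (φ k) m)).re - ‖h' m‖ ^ 2))
        + (∑ m, ∑ n, Λ m n * (inner ℂ (u (φ k)) (matOp M (lift pauliZ n) (h (φ k) m))).re)
        - (inner ℂ (u (φ k)) (matOp M (tunneling t) (u (φ k)))).re)
      ?_ (hElim.comp hφ.tendsto_atTop) (Eventually.of_forall fun k => ?_)
    · refine Tendsto.sub (Tendsto.add (Tendsto.add ?_ ?_) ?_) (hmat _)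
      · exact tendsto_finsetSum _ fun m _ => (hg' m).tendsto_two_re_inner_sub
      · exact tendsto_finsetSum _ fun m _ => (hh' m).tendsto_two_re_inner_sub
      · refine tendsto_finsetSum _ fun m _ => tendsto_finsetSum _ fun n _ => ?_
        refine (hre (((hh' m).map (matOp M (lift pauliZ n))).inner_of_tendsto hlim
          (C := ‖matOp M (lift pauliZ n : Matrix (Spin N) _ ℂ)‖ * C) fun k => ?_)).const_mul _
        refine ((matOp M (lift pauliZ n)).le_opNorm _).trans ?_
        gcongr
        exact Real.le_sqrt_of_sq_le (hgB m (φ k)).2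
    · rw [Function.comp_apply, ← huE, (H (φ k)).energy_eq Λ t]
      exact sub_le_sub_right (add_le_add (add_le_add
        (Finset.sum_le_sum fun _ _ => two_re_inner_sub_le _ _)
        (Finset.sum_le_sum fun _ _ => two_re_inner_sub_le _ _)) le_rfl) _
  exact fun χ hχ => hle.trans (csInf_le hbdd ⟨χ, hχ, rfl⟩)

end Minimizer

/-! ### A trial state satisfying the constraints -/

section TrialState

variable {M N : ℕ}

/-- The elementary tensor of the one-particle spinors `w k`. -/
noncomputable def productSpinor (w : Fin N → Fin 2 → ℂ) : Spinor N :=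
  WithLp.toLp 2 fun α => ∏ k, w k (α k)

/-- By distributivity the sum over multi-indices factors into one sum per site. -/
theorem toEuclideanCLM_lift_productSpinor (A : Matrix (Fin 2) (Fin 2) ℂ) (n : Fin N)
    (w : Fin N → Fin 2 → ℂ) :
    Matrix.toEuclideanCLM (n := Spin N) (𝕜 := ℂ) (lift A n) (productSpinor w) =
      productSpinor fun k => Matrix.mulVec (if k = n then A else 1) (w k) := by
  ext α
  rw [productSpinor, Matrix.toEuclideanCLM_toLp]
  simp only [productSpinor, Matrix.mulVec, dotProduct, lift, Matrix.of_apply,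
    ← Finset.prod_mul_distrib]
  rw [Finset.prod_univ_sum, Fintype.piFinset_univ]

theorem inner_productSpinor (w z : Fin N → Fin 2 → ℂ) :
    inner ℂ (productSpinor w) (productSpinor z) =
      ∏ k, ∑ a, z k a * starRingEnd ℂ (w k a) := by
  rw [productSpinor, productSpinor, PiLp.inner_apply, Finset.prod_univ_sum, Fintype.piFinset_univ]
  simp [Finset.prod_mul_distrib]

/-- The spinor `⊗ₖ (√((1+σₖ)/2), √((1-σₖ)/2))` with magnetization `σ`. -/
noncomputable def polarizedSpinor (σ : Fin N → ℝ) : Spinor N :=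
  productSpinor fun k => ![((√((1 + σ k) / 2) : ℝ) : ℂ), ((√((1 - σ k) / 2) : ℝ) : ℂ)]

theorem norm_polarizedSpinor {σ : Fin N → ℝ} (hσ : ∀ n, σ n ∈ Set.Icc (-1 : ℝ) 1) :
    ‖polarizedSpinor σ‖ = 1 := by
  have h1 : inner ℂ (polarizedSpinor σ) (polarizedSpinor σ) = 1 := by
    rw [polarizedSpinor, inner_productSpinor]
    refine Finset.prod_eq_one fun k _ => ?_
    have h2 : 0 ≤ (1 + σ k) / 2 := by linarith [(hσ k).1]
    have h3 : 0 ≤ (1 - σ k) / 2 := by linarith [(hσ k).2]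
    simp only [Fin.sum_univ_two, Matrix.cons_val_zero, Matrix.cons_val_one, Complex.conj_ofReal,
      ← Complex.ofReal_mul, Real.mul_self_sqrt h2, Real.mul_self_sqrt h3]
    push_cast
    ring
  have h4 : ‖polarizedSpinor σ‖ ^ 2 = 1 := by
    rw [← inner_self_eq_norm_sq (𝕜 := ℂ), h1, RCLike.one_re]
  exact (pow_eq_one_iff_of_nonneg (norm_nonneg _) two_ne_zero).1 h4

/-- Site `n` contributes `(1+σₙ)/2 - (1-σₙ)/2 = σₙ`; every other site contributes its squared norm,
one. -/
theorem inner_lift_pauliZ_polarizedSpinor {σ : Fin N → ℝ}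
    (hσ : ∀ n, σ n ∈ Set.Icc (-1 : ℝ) 1) (n : Fin N) :
    inner ℂ (polarizedSpinor σ) (Matrix.toEuclideanCLM (n := Spin N) (𝕜 := ℂ) (lift pauliZ n)
      (polarizedSpinor σ)) = (σ n : ℂ) := by
  rw [polarizedSpinor, toEuclideanCLM_lift_productSpinor, inner_productSpinor]
  rw [Finset.prod_eq_single n]
  · have h2 : 0 ≤ (1 + σ n) / 2 := by linarith [(hσ n).1]
    have h3 : 0 ≤ (1 - σ n) / 2 := by linarith [(hσ n).2]
    simp only [if_true, Fin.sum_univ_two, pauliZ, Matrix.mulVec, dotProduct, Matrix.of_apply,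
      Matrix.cons_val_zero, Matrix.cons_val_one, Complex.conj_ofReal, one_mul, zero_mul, add_zero,
      zero_add, neg_mul, ← Complex.ofReal_mul, Real.mul_self_sqrt h2, Real.mul_self_sqrt h3]
    push_cast
    ring
  · intro k _ hk
    have h2 : 0 ≤ (1 + σ k) / 2 := by linarith [(hσ k).1]
    have h3 : 0 ≤ (1 - σ k) / 2 := by linarith [(hσ k).2]
    simp only [if_neg hk, Matrix.one_mulVec, Fin.sum_univ_two, Matrix.cons_val_zero,
      Matrix.cons_val_one, Complex.conj_ofReal,
      ← Complex.ofReal_mul, Real.mul_self_sqrt h2, Real.mul_self_sqrt h3]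
    push_cast
    ring
  · simp

/-- Schwartz functions belong to the form domain. -/
theorem toLp_mem_formDomain (f : 𝓢(Modes M, Spinor N)) :
    (f.toLp 2 volume : State M N) ∈ formDomain M N := by
  refine mem_formDomain_iff.2 ⟨fun m => (∂_{(EuclideanSpace.single m 1 : Modes M)} f).toLp 2 volume,
    fun m => (SchwartzMap.smulLeftCLM (Spinor N)
      (fun x : Modes M => ((x m : ℝ) : ℂ)) f).toLp 2 volume, fun m => ?_, fun m => ?_⟩
  · rw [IsWeakDeriv, Lp.toTemperedDistribution_toLp_eq, Lp.toTemperedDistribution_toLp_eq,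
      TemperedDistribution.lineDerivOp_toTemperedDistributionCLM_eq]
  · rw [coordMul_toDistr_eq_iff]
    filter_upwards [f.coeFn_toLp 2 volume, SchwartzMap.coeFn_toLp (SchwartzMap.smulLeftCLM (Spinor N)
      (fun x : Modes M => ((x m : ℝ) : ℂ)) f) 2 volume] with x h1 h2
    rw [h1, h2, SchwartzMap.smulLeftCLM_apply_apply (hasTemperateGrowth_coord m)]

/-- A normalized test function that is symmetric about `ξ`. -/
theorem exists_symmetric_testFunction (ξ : Modes M) :
    ∃ b : Modes M → ℝ, ContDiff ℝ (⊤ : ℕ∞) b ∧ HasCompactSupport b ∧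
      ∫ x, b x ^ 2 = 1 ∧ ∀ m, ∫ x, x m * b x ^ 2 = ξ m := by
  let c : ContDiffBump (0 : Modes M) := default
  have hcont : Continuous fun x => c x ^ 2 := c.continuous.pow 2
  have hsupp : HasCompactSupport fun x => c x ^ 2 := by
    simp only [pow_two]
    exact c.hasCompactSupport.mul_left
  have hint : Integrable (fun x => c x ^ 2) volume := hcont.integrable_of_hasCompactSupport hsupp
  have hpos : 0 < ∫ x, c x ^ 2 := by
    refine hcont.integral_pos_of_hasCompactSupport_nonneg_nonzero hsupp (fun x => sq_nonneg _)
      (x := 0) ?_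
    rw [c.one_of_mem_closedBall (by simpa using c.rIn_pos.le)]
    norm_num
  set I := ∫ x, c x ^ 2 with hI
  have hsq : ∀ x, (√I⁻¹ * c x) ^ 2 = I⁻¹ * c x ^ 2 := fun x => by
    rw [mul_pow, Real.sq_sqrt (by positivity)]
  refine ⟨fun x => √I⁻¹ * c (x - ξ), ?_, ?_, ?_, fun m => ?_⟩
  · exact contDiff_const.mul (c.contDiff.comp (contDiff_id.sub contDiff_const))
  · exact (c.hasCompactSupport.comp_homeomorph (Homeomorph.subRight ξ)).mul_left
  · simp only [hsq]
    rw [integral_const_mul, integral_sub_right_eq_self (fun x => c x ^ 2) ξ, inv_mul_cancel₀ hpos.ne']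
  · have h1 : ∫ x : Modes M, x m * (√I⁻¹ * c (x - ξ)) ^ 2 =
        ∫ x : Modes M, (x + ξ) m * (I⁻¹ * c x ^ 2) := by
      rw [← integral_sub_right_eq_self (fun x : Modes M => (x + ξ) m * (I⁻¹ * c x ^ 2)) ξ]
      simp only [hsq, sub_add_cancel]
    -- The bump `c` is even, so the integrand is odd.
    have hodd : ∫ x : Modes M, x m * (I⁻¹ * c x ^ 2) = 0 := by
      have h2 := integral_neg_eq_self (fun x : Modes M => x m * (I⁻¹ * c x ^ 2)) volume
      simp only [PiLp.neg_apply, c.neg, neg_mul, integral_neg] at h2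
      linarith
    have hint2 : Integrable (fun x : Modes M => x m * (I⁻¹ * c x ^ 2)) volume := by
      refine Continuous.integrable_of_hasCompactSupport (by fun_prop) ?_
      exact (hsupp.mul_left (f := fun _ => I⁻¹)).mul_left
    rw [h1]
    simp only [PiLp.add_apply, add_mul]
    rw [integral_add hint2 ((hint.const_mul _).const_mul _), hodd, integral_const_mul,
      integral_const_mul, inv_mul_cancel₀ hpos.ne']
    ring

/-- For `b(x) v` the constraints decouple: the spinor `v` fixes the magnetization, the scalar
profile `b` the displacement. -/
theorem constraintSet_nonempty {σ : Fin N → ℝ} (hσ : ∀ n, σ n ∈ Set.Icc (-1 : ℝ) 1)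
    (ξ : Fin M → ℝ) : (constraintSet σ ξ : Set (State M N)).Nonempty := by
  obtain ⟨b, hb, hbs, hb1, hbξ⟩ := exists_symmetric_testFunction (WithLp.toLp 2 ξ)
  set v := polarizedSpinor σ with hv
  have hv1 : ‖v‖ = 1 := norm_polarizedSpinor hσ
  have hs : HasCompactSupport fun x => b x • v := hbs.smul_right
  have hc : ContDiff ℝ (⊤ : ℕ∞) fun x => b x • v := hb.smul contDiff_const
  let f := hs.toSchwartzMap hc
  have hae : ∀ᵐ x, (f.toLp 2 volume : State M N) x = (b x : ℂ) • v := by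
    filter_upwards [f.coeFn_toLp 2 volume] with x hx
    rw [hx]
    simp [f]
  refine ⟨f.toLp 2 volume, mem_constraintSet_iff.2 ⟨toLp_mem_formDomain f, ?_, ?_, ?_⟩⟩
  · have h1 : ‖(f.toLp 2 volume : State M N)‖ ^ 2 = 1 := by
      rw [norm_sq_eq_integral, ← hb1]
      refine integral_congr_ae ?_
      filter_upwards [hae] with x hx
      simp [hx, norm_smul, hv1]
    exact (pow_eq_one_iff_of_nonneg (norm_nonneg _) two_ne_zero).1 h1
  · ext n
    rw [magnetization, re_inner_eq_integral, ← one_mul (σ n), ← hb1, ← integral_mul_const]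
    refine integral_congr_ae ?_
    filter_upwards [hae, coeFn_matOp (lift pauliZ n) (f.toLp 2 volume : State M N)] with x hx hx2
    rw [hx2, hx, map_smul, inner_smul_left, inner_smul_right, hv,
      inner_lift_pauliZ_polarizedSpinor hσ, Complex.conj_ofReal]
    norm_cast
    ring
  · ext m
    refine Eq.trans ?_ (hbξ m)
    refine integral_congr_ae ?_
    filter_upwards [hae] with x hx
    simp [hx, norm_smul, hv1]

end TrialState

end Dicke

/-- The infimum in the Levy–Lieb functional is attained. The last conjunct says that the value is
a true minimum, so that the real infimum is not a default value. -/
theorem theorem3p5 {M N : ℕ} (Λ : Matrix (Fin M) (Fin N) ℝ) (t : Fin N → ℝ) (ht : t ≠ 0)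
    (σ : Fin N → ℝ) (hσ : ∀ n, σ n ∈ Set.Icc (-1 : ℝ) 1) (ξ : Fin M → ℝ) :
    ∃ ψ ∈ Dicke.constraintSet σ ξ,
      Dicke.levyLieb Λ t σ ξ = Dicke.energy Λ t ψ ∧
      ∀ φ ∈ Dicke.constraintSet σ ξ, Dicke.energy Λ t ψ ≤ Dicke.energy Λ t φ := by
  obtain ⟨ψ, hψ, hmin⟩ :=
    Dicke.exists_isMinOn_energy Λ t (Dicke.constraintSet_nonempty (M := M) hσ ξ)
  refine ⟨ψ, hψ, IsLeast.csInf_eq ⟨⟨ψ, hψ, rfl⟩, ?_⟩, hmin⟩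
  rintro _ ⟨φ, hφ, rfl⟩
  exact hmin φ hφ
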